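/- Fix integers $e,r\ge 1$, put $c=e+r$ and $\mathcal A=\{0,1,\dots,c\}$, and let $T\colon\mathcal A^{\mathbb Z}\to\mathcal A^{\mathbb Z}$ be the one-dimensional Greenberg–Hastings cellular automaton: $T(x)_k=E(x_k)+D(x_k;x_{k+1},x_{k-1})$, where $E(a)=a+1$ for $1\le a\le c-1$ and $E(c)=E(0)=0$, and where $D(u;v_1,v_2)=1$ if $u=0$ and $1\le v_i\le e$ for $i=1$ or $i=2$, and $D(u;v_1,v_2)=0$ otherwise. Call $i\to j$ (with $i,j\in\mathcal A$) allowed if $i=j=0$ or $j\equiv i+1 \pmod{c+1}$. Let $S_L$ (resp. $S_R$) be the set of $x\in\mathcal A^{\mathbb Z}$ such that $x_i\to x_{i+1}$ (resp. $x_i\to x_{i-1}$) is allowed for all $i\in\mathbb Z$. Say that $x$ is right-moving up to $p$ if $x_i\to x_{i-1}$ is allowed for all $i\le p$, and left-moving from $p$ if $x_i\to x_{i+1}$ is allowed for all $i\ge p$. An integer $p$ is a separating position of $x$ if $x$ is right-moving up to $p$ and left-moving from $p+1$. Let $S_{LR}$ be the set of $x\notin S_L\cup S_R$ that have a separating position.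 The pulse collision subsystem $Z=Z_c$ consists of all $x\in S_L\cup S_R$ and of all $x\in S_{LR}$ that have a largest separating position $p$ such that either $x_{p+1}=x_p$, or $x$ is right-moving up to $p$ and left-moving from $p$. For $c\ge 1$ let $\rho_c$ be the largest positive root of $\lambda^{c+1}-\lambda^c-1$ (it exists), and let $h(Z,S)$ be the topological entropy of $S$ restricted to $Z$, where $\mathcal A^{\mathbb Z}$ carries the product of the discrete topologies. Then for every $\alpha\colon\mathbb N\to\mathbb N$ (where $f\sim g$ means $f-g=o(g)$): 1. For all $e,r\ge1$ and $c=e+r$, $\; h(Z,T^{\alpha(c)})=2\ln\bigl(\rho_c^{\alpha(c)}\bigr)$. 2. $2\ln\bigl(\rho_c^{\alpha(c)}\bigr)\sim 2\alpha(c)\frac{\ln c}{c}$ as $c\to\infty$; hence $h(Z,T^{\alpha(c)})\sim 2\alpha(c)\frac{\ln c}{c}$ as $c=e+r\to\infty$, where $(e,r)$ ranges over the pairs of positive integers. 3. For every $c\ge 1$ the full $c$-shift (the left shift on $\{1,\dots,c\}^{\mathbb Z}$) has topological entropy $h_c=\ln c$, and for $\alpha(c)=c$ one has $h(Z,T^{c})\sim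 2h_c$ as $c=e+r\to\infty$ over the pairs $(e,r)$ of positive integers. -/

import Mathlib

open Filter Asymptotics

namespace GreenbergHastings

/-- The reaction term: `k ↦ k + 1` for `1 ≤ k ≤ e + r - 1`, while `e + r ↦ 0` and `0 ↦ 0`. The
alphabet `{0, 1, …, e + r}` is `Fin (e + r + 1)`. -/
def reaction (e r : ℕ) (k : Fin (e + r + 1)) : Fin (e + r + 1) :=
  if h : 1 ≤ k.val ∧ k.val < e + r then ⟨k.val + 1, by omega⟩ else 0

/-- The interaction term: `1` if the cell `u` is at rest and at least one of its two neighbours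
is in one of the excited states `1, …, e`, and `0` otherwise. -/
def interaction (e r : ℕ) (u v₁ v₂ : Fin (e + r + 1)) : Fin (e + r + 1) :=
  if u = 0 ∧ ((1 ≤ v₁.val ∧ v₁.val ≤ e) ∨ (1 ≤ v₂.val ∧ v₂.val ≤ e)) then 1 else 0

/-- The one-dimensional Greenberg–Hastings cellular automaton with `e` excited and `r` refractory
states. (One of the two summands is always `0`, so the sum does not wrap around.) -/
def T (e r : ℕ) (x : ℤ → Fin (e + r + 1)) : ℤ → Fin (e + r + 1) :=
  fun k => reaction e r (x k) + interaction e r (x k) (x (k + 1)) (x (k - 1))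

/-- The transition matrix on the states `{0, …, c}`: the transitions are `0 → 0` and `i → i + 1`
modulo `c + 1`. -/
def transition (c : ℕ) : Matrix (Fin (c + 1)) (Fin (c + 1)) ℕ :=
  Matrix.of fun i j => if (i = 0 ∧ j = 0) ∨ j = i + 1 then 1 else 0

/-- Right-moving multi-pulses. -/
def SR (c : ℕ) : Set (ℤ → Fin (c + 1)) :=
  {x | ∀ i : ℤ, transition c (x i) (x (i - 1)) = 1}

/-- Left-moving multi-pulses. -/
def SL (c : ℕ) : Set (ℤ → Fin (c + 1)) :=
  {x | ∀ i : ℤ, transition c (x i) (x (i + 1)) = 1}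

/-- The restriction of `x` to `(-∞, p]` is a semi-infinite right-moving multi-pulse. -/
def RightMovingUpTo {c : ℕ} (x : ℤ → Fin (c + 1)) (p : ℤ) : Prop :=
  ∀ i : ℤ, i ≤ p → transition c (x i) (x (i - 1)) = 1

/-- The restriction of `x` to `[p, ∞)` is a semi-infinite left-moving multi-pulse. -/
def LeftMovingFrom {c : ℕ} (x : ℤ → Fin (c + 1)) (p : ℤ) : Prop :=
  ∀ i : ℤ, p ≤ i → transition c (x i) (x (i + 1)) = 1

/-- The (finite) separating positions of `x`. -/
def separatingPositions {c : ℕ} (x : ℤ → Fin (c + 1)) : Set ℤ :=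
  {p | RightMovingUpTo x p ∧ LeftMovingFrom x (p + 1)}

/-- Configurations composed of two semi-infinite counter-propagating parts. -/
def SLR (c : ℕ) : Set (ℤ → Fin (c + 1)) :=
  {x | (separatingPositions x).Nonempty} \ (SR c ∪ SL c)

/-- The pulse collision subsystem `Z`; it depends on `c = e + r` only. -/
def Z (c : ℕ) : Set (ℤ → Fin (c + 1)) :=
  SR c ∪ SL c ∪
    {x | x ∈ SLR c ∧ ∃ p : ℤ, IsGreatest (separatingPositions x) p ∧
      (x (p + 1) = x p ∨ (RightMovingUpTo x p ∧ LeftMovingFrom x p))}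

/-- The topological entropy of the restriction of `S : A^ℤ → A^ℤ` to `F`, where `A` carries the
discrete uniformity and `A^ℤ` the product uniformity. -/
noncomputable def topEntropy {A : Type} (S : (ℤ → A) → (ℤ → A)) (F : Set (ℤ → A)) : EReal :=
  letI : UniformSpace A := ⊥
  Dynamics.coverEntropy S F

/-- The left shift on `A^ℤ`. -/
def leftShift {A : Type} (x : ℤ → A) : ℤ → A := fun k => x (k + 1)

/-- The positive real roots of `λ ^ (c + 1) - λ ^ c - 1`. -/
def positiveRoots (c : ℕ) : Set ℝ := {x : ℝ | 0 < x ∧ x ^ (c + 1) - x ^ c - 1 = 0}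

/-- `ρ_c`, the largest positive root of `λ ^ (c + 1) - λ ^ c - 1`. -/
noncomputable def rho (c : ℕ) : ℝ := sSup (positiveRoots c)

/-- The limit `c = e + r → ∞` over pairs `(e, r)` of positive integers. -/
def sumToInfinity : Filter (ℕ × ℕ) :=
  comap (fun p : ℕ × ℕ => p.1 + p.2) atTop ⊓ 𝓟 {p : ℕ × ℕ | 1 ≤ p.1 ∧ 1 ≤ p.2}

end GreenbergHastings

open GreenbergHastings

/-! Both bounds count words admissible for `transition`. Its characteristic equation gives the
growth rate `rho c`, and the positive eigenvector `weight` turns this into explicit bounds on word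
counts.

Upper bound: `T` has radius one, so `n` steps of `T^a` seen on `[-m, m]` depend only on the cells
within `m + a * n` of the origin. There a point of `Z` consists of two admissible words with a fixed
total number of transitions, split at one of linearly many places. This gives at most a linear
factor times `rho ^ (2 * a * n)` patterns.

Lower bound: the two halves of a configuration should be readable independently although they
annihilate at the collision. Suitable configurations are residues mod `c + 1` of an integer height
function, and on heights `T` is the maximum over a cell and its neighbours (`T_ofHeight`). After `t`
steps the height at `s` is the maximum over `[s - t, s + t]`; if neither half outruns the other by
more than a bounded delay, the cells `s` and `-s` still read their own halves. The halves are kept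
level by concatenating loops at `0` of common length `N` and common height `H`. There are only `N +
1` heights, so pigeonhole keeps the exponential growth rate of all loops of length `N`; then `N →
∞`.

Asymptotics: for `y = c * log (rho c)`, the equation `rho ^ c * (rho - 1) = 1` puts `y * exp y`
close to `c`, whence `y ∼ log c`. -/

namespace GreenbergHastings

/-! ### Counting criteria for topological entropy -/

/-- Pairs of configurations which agree on `[-m, m]`. -/
def window (A : Type) (m : ℕ) : SetRel (ℤ → A) (ℤ → A) :=
  {p | ∀ j : ℤ, |j| ≤ m → p.1 j = p.2 j}

theorem window_hasBasis {A : Type} :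
    letI : UniformSpace A := ⊥
    (uniformity (ℤ → A)).HasBasis (fun _ : ℕ => True) (window A) := by
  let _ : UniformSpace A := ⊥
  have hb : (uniformity (ℤ → A)).HasBasis (fun I : Set ℤ => I.Finite)
      (fun I => {p | ∀ j ∈ I, p.1 j = p.2 j}) := by
    have h1 : ∀ j : ℤ, (comap (fun a : (ℤ → A) × (ℤ → A) => (a.1 j, a.2 j))
        (uniformity A)).HasBasis (fun _ : Unit => True) (fun _ => {p | p.1 j = p.2 j}) := by
      intro j
      rw [show uniformity A = 𝓟 SetRel.id from rfl, comap_principal]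
      exact hasBasis_principal _
    rw [Pi.uniformity]
    have := HasBasis.iInf' h1
    refine ⟨fun t => ?_⟩
    rw [this.mem_iff]
    constructor
    · rintro ⟨⟨I, f⟩, ⟨hI, -⟩, h⟩
      refine ⟨I, hI, fun p hp => h ?_⟩
      simpa using hp
    · rintro ⟨I, hI, h⟩
      refine ⟨⟨I, fun _ => ()⟩, ⟨hI, fun _ _ => trivial⟩, fun p hp => h ?_⟩
      simpa using hp
  refine ⟨fun t => ?_⟩
  rw [hb.mem_iff]
  constructor
  · rintro ⟨I, hI, h⟩
    obtain ⟨m, hm⟩ : ∃ m : ℕ, ∀ j ∈ I, |j| ≤ m := by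
      obtain ⟨M, hM⟩ := (hI.image (fun j => |j|)).bddAbove
      exact ⟨M.toNat, fun j hj => (hM ⟨j, hj, rfl⟩).trans (Int.self_le_toNat M)⟩
    exact ⟨m, trivial, fun p hp => h fun j hj => hp j (hm j hj)⟩
  · rintro ⟨m, -, h⟩
    refine ⟨Set.Icc (-(m : ℤ)) m, Set.finite_Icc _ _, fun p hp => h fun j hj => hp j ?_⟩
    exact abs_le.mp hj

theorem topEntropy_eq_iSup {A : Type} (S : (ℤ → A) → (ℤ → A)) (F : Set (ℤ → A)) :
    topEntropy S F = ⨆ m : ℕ, Dynamics.coverEntropyEntourage S F (window A m) := by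
  let _ : UniformSpace A := ⊥
  unfold topEntropy
  rw [Dynamics.coverEntropy_eq_iSup_basis window_hasBasis]
  simp

/-- Covers may use centres outside `F`, so a convenient superset of the patterns can be counted. -/
theorem topEntropy_le {A : Type} {S : (ℤ → A) → (ℤ → A)} {F : Set (ℤ → A)} {b : ℝ}
    (h : ∀ m : ℕ, ∀ᶠ n : ℕ in atTop, ∃ s : Finset (ℤ → A), (s.card : ℝ) ≤ Real.exp (b * n) ∧
      ∀ x ∈ F, ∃ y ∈ s, ∀ k < n, ∀ j : ℤ, |j| ≤ m → S^[k] x j = S^[k] y j) :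
    topEntropy S F ≤ b := by
  rw [topEntropy_eq_iSup]
  refine iSup_le fun m => Eventually.expGrowthSup_le ?_
  filter_upwards [h m] with n ⟨s, hs, hF⟩
  have hc : Dynamics.IsDynCoverOf S F (window A m) n s := by
    intro x hx
    obtain ⟨y, hy, hxy⟩ := hF x hx
    exact ⟨y, hy, Dynamics.mem_dynEntourage.2 fun k hk j hj => hxy k hk j hj⟩
  have h1 : ((Dynamics.coverMincard S F (window A m) n : ℕ∞) : ENNReal) ≤ (s.card : ENNReal) := by
    exact_mod_cast ENat.toENNReal_mono hc.coverMincard_le_card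
  refine h1.trans ?_
  rw [show ((b : EReal) * (n : EReal)) = ((b * n : ℝ) : EReal) by push_cast; rfl,
    EReal.exp_coe, ← ENNReal.ofReal_natCast]
  exact ENNReal.ofReal_le_ofReal hs

/-- Entropy is a supremum over windows of upper growth rates, so one window and infinitely many
times suffice. -/
theorem le_topEntropy {A : Type} {S : (ℤ → A) → (ℤ → A)} {F : Set (ℤ → A)} {b : ℝ} (m : ℕ)
    (h : ∃ᶠ n : ℕ in atTop, ∃ s : Finset (ℤ → A), Real.exp (b * n) ≤ s.card ∧ (s : Set (ℤ → A)) ⊆ F ∧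
      ∀ x ∈ s, ∀ y ∈ s, (∀ k < n, ∀ j : ℤ, |j| ≤ m → S^[k] x j = S^[k] y j) → x = y) :
    b ≤ topEntropy S F := by
  rw [topEntropy_eq_iSup]
  refine le_trans ?_ (le_iSup _ m)
  refine le_trans ?_ (Dynamics.netEntropyEntourage_le_coverEntropyEntourage S F)
  refine Frequently.le_expGrowthSup ?_
  refine h.mono ?_
  rintro n ⟨s, hs, hF, hsep⟩
  have hc : Dynamics.IsDynNetIn S F (window A m) n s := by
    refine ⟨hF, fun x hx y hy hxy => ?_⟩
    rw [Function.onFun, Set.disjoint_left]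
    intro z hz hz'
    refine hxy (hsep x hx y hy fun k hk j hj => ?_)
    have h1 := Dynamics.mem_dynEntourage.1 hz k hk j hj
    have h2 := Dynamics.mem_dynEntourage.1 hz' k hk j hj
    exact h1.trans h2.symm
  have h1 : (s.card : ENNReal) ≤ ((Dynamics.netMaxcard S F (window A m) n : ℕ∞) : ENNReal) := by
    exact_mod_cast ENat.toENNReal_mono hc.card_le_netMaxcard
  refine le_trans ?_ h1
  rw [show ((b : EReal) * (n : EReal)) = ((b * n : ℝ) : EReal) by push_cast; rfl,
    EReal.exp_coe, ← ENNReal.ofReal_natCast]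
  exact ENNReal.ofReal_le_ofReal hs

theorem eventually_affine_mul_exp_le (A B : ℝ) {a b : ℝ} (hab : a < b) :
    ∀ᶠ n : ℕ in atTop, (A + B * n) * Real.exp (a * n) ≤ Real.exp (b * n) := by
  have h1 : (fun x : ℝ => A + B * x) =o[atTop] fun x => Real.exp ((b - a) * x) := by
    refine IsLittleO.add ?_ (IsLittleO.const_mul_left ?_ B)
    · have := isLittleO_pow_exp_pos_mul_atTop 0 (sub_pos.2 hab)
      simpa using this.const_mul_left A
    · simpa using isLittleO_pow_exp_pos_mul_atTop 1 (sub_pos.2 hab)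
  have h2 := (h1.comp_tendsto tendsto_natCast_atTop_atTop).bound one_pos
  filter_upwards [h2] with n hn
  simp only [Function.comp, Real.norm_eq_abs, one_mul, Real.abs_exp] at hn
  calc (A + B * n) * Real.exp (a * n) ≤ Real.exp ((b - a) * n) * Real.exp (a * n) := by
        gcongr; exact (le_abs_self _).trans hn
    _ = Real.exp (b * n) := by rw [← Real.exp_add]; ring_nf

theorem le_coe_of_forall_gt {x : EReal} {a : ℝ} (h : ∀ b : ℝ, a < b → x ≤ b) : x ≤ a := by
  refine le_of_forall_gt_imp_ge_of_dense fun y hy => ?_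
  obtain ⟨b, hb, hby⟩ := EReal.lt_iff_exists_real_btwn.1 hy
  exact (h b (by exact_mod_cast hb)).trans hby.le

/-! ### The full shift -/

theorem leftShift_iterate {A : Type} (n : ℕ) (x : ℤ → A) (j : ℤ) :
    leftShift^[n] x j = x (j + n) := by
  induction n generalizing j with
  | zero => simp
  | succ n ih =>
    rw [Function.iterate_succ_apply']
    simp only [leftShift, ih]
    congr 1; push_cast; ring

theorem topEntropy_fullShift (c : ℕ) (hc : 1 ≤ c) :
    topEntropy (leftShift : (ℤ → Fin c) → (ℤ → Fin c)) Set.univ = (Real.log c : ℝ) := by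
  have hexp : ∀ n : ℕ, Real.exp (Real.log c * n) = (c : ℝ) ^ n := fun n => by
    rw [mul_comm, Real.exp_nat_mul, Real.exp_log (by exact_mod_cast hc)]
  have : NeZero c := ⟨by omega⟩
  classical
  apply le_antisymm
  · refine le_coe_of_forall_gt fun b hb => topEntropy_le fun m => ?_
    filter_upwards [eventually_affine_mul_exp_le ((c : ℝ) ^ (2 * m + 1)) 0 hb] with n hn
    -- The word occupies `[-m, m + n]`, which contains every cell observed before time `n`; values
    -- elsewhere are irrelevant.
    let dec : (Fin (2 * m + 1 + n) → Fin c) → (ℤ → Fin c) :=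
      fun u j => if h : (j + m).toNat < 2 * m + 1 + n then u ⟨(j + m).toNat, h⟩ else 0
    refine ⟨Finset.univ.image dec, ?_, fun x _ => ?_⟩
    · refine le_trans (Nat.cast_le.2 Finset.card_image_le) (le_trans ?_ hn)
      rw [hexp]
      simp [pow_add]
    · refine ⟨dec fun i => x (i - m), Finset.mem_image_of_mem _ (Finset.mem_univ _), ?_⟩
      intro k hk j hj
      rw [leftShift_iterate, leftShift_iterate]
      have := abs_le.1 hj
      have h1 : (j + k + m).toNat < 2 * m + 1 + n := by omega
      simp only [dec, dif_pos h1]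
      congr 1
      omega
  · refine le_topEntropy 0 (Eventually.frequently (Eventually.of_forall fun n => ?_))
    let pt : (Fin n → Fin c) → (ℤ → Fin c) :=
      fun u j => if h : j.toNat < n then u ⟨j.toNat, h⟩ else 0
    have hpt : ∀ u (i : Fin n), pt u i = u i := fun u i => by simp [pt]
    refine ⟨Finset.univ.image pt, ?_, Set.subset_univ _, ?_⟩
    · rw [Finset.card_image_of_injective, hexp]
      · simp
      · intro u v huv
        ext i : 1
        rw [← hpt u, huv, hpt]
    · intro x hx y hy h
      obtain ⟨u, -, rfl⟩ := Finset.mem_image.1 hx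
      obtain ⟨v, -, rfl⟩ := Finset.mem_image.1 hy
      congr 1
      ext i : 1
      have := h i i.2 0 (by simp)
      rwa [leftShift_iterate, leftShift_iterate, zero_add, hpt, hpt] at this

/-! ### The growth rate `rho c` -/

theorem one_lt_of_mem_positiveRoots {c : ℕ} {x : ℝ} (h : x ∈ positiveRoots c) : 1 < x := by
  obtain ⟨hx, h⟩ := h
  have h1 : x ^ c * (x - 1) = 1 := by rw [pow_succ] at h; linarith
  have h2 : 0 < x ^ c := pow_pos hx c
  by_contra! h3
  nlinarith

theorem le_two_of_mem_positiveRoots {c : ℕ} {x : ℝ} (h : x ∈ positiveRoots c) : x ≤ 2 := by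
  have h0 := one_lt_of_mem_positiveRoots h
  obtain ⟨hx, h⟩ := h
  have h1 : x ^ c * (x - 1) = 1 := by rw [pow_succ] at h; linarith
  have h2 : 1 ≤ x ^ c := one_le_pow₀ h0.le
  nlinarith

/-- All positive roots lie in `[1, 2]`, so they form a compact set; a sign change makes it nonempty.
-/
theorem isGreatest_rho (c : ℕ) : IsGreatest (positiveRoots c) (rho c) := by
  have heq : positiveRoots c = Set.Icc 1 2 ∩ {x : ℝ | x ^ (c + 1) - x ^ c - 1 = 0} := by
    ext x
    constructor
    · intro h
      exact ⟨⟨(one_lt_of_mem_positiveRoots h).le, le_two_of_mem_positiveRoots h⟩, h.2⟩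
    · rintro ⟨⟨h1, -⟩, h2⟩
      exact ⟨by linarith, h2⟩
  have hcont : Continuous fun x : ℝ => x ^ (c + 1) - x ^ c - 1 := by fun_prop
  have hcomp : IsCompact (positiveRoots c) := by
    rw [heq]
    exact isCompact_Icc.inter_right (isClosed_singleton.preimage hcont)
  have hne : (positiveRoots c).Nonempty := by
    have h2 : (1 : ℝ) ≤ 2 ^ c := one_le_pow₀ one_le_two
    obtain ⟨x, hx, hx0⟩ := intermediate_value_Icc (one_le_two (α := ℝ)) hcont.continuousOn
      (show (0 : ℝ) ∈ _ by constructor <;> simp [pow_succ]; linarith)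
    exact ⟨x, by linarith [hx.1], hx0⟩
  exact hcomp.isGreatest_sSup hne

theorem one_lt_rho (c : ℕ) : 1 < rho c := one_lt_of_mem_positiveRoots (isGreatest_rho c).1

theorem rho_pos (c : ℕ) : 0 < rho c := one_pos.trans (one_lt_rho c)

theorem rho_pow_succ (c : ℕ) : rho c ^ (c + 1) = rho c ^ c + 1 := by
  linarith [(isGreatest_rho c).1.2]

theorem rho_pow_mul (c : ℕ) : rho c ^ c * (rho c - 1) = 1 := by
  linarith [rho_pow_succ c, pow_succ (rho c) c]

theorem log_rho_pos (c : ℕ) : 0 < Real.log (rho c) := Real.log_pos (one_lt_rho c)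

/-- From `log rho ≤ rho - 1 = rho ^ (-c)`. The reverse estimate below uses `1 - 1 / rho ≤ log rho`
and loses only a factor `rho`. -/
theorem mul_log_rho_mul_exp_le (c : ℕ) :
    c * Real.log (rho c) * Real.exp (c * Real.log (rho c)) ≤ c := by
  have h1 : Real.exp (c * Real.log (rho c)) = rho c ^ c := by
    rw [Real.exp_nat_mul, Real.exp_log (rho_pos c)]
  rw [h1, mul_assoc]
  have h2 := Real.log_le_sub_one_of_pos (rho_pos c)
  have h3 := rho_pow_mul c
  have h4 : 0 < rho c ^ c := pow_pos (rho_pos c) c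
  have : Real.log (rho c) * rho c ^ c ≤ 1 := by nlinarith
  nlinarith [(Nat.cast_nonneg c : (0 : ℝ) ≤ c)]

theorem le_mul_log_rho_mul_exp (c : ℕ) :
    (c : ℝ) ≤ c * Real.log (rho c) * Real.exp (c * Real.log (rho c) + Real.log (rho c)) := by
  have h1 : Real.exp (c * Real.log (rho c)) = rho c ^ c := by
    rw [Real.exp_nat_mul, Real.exp_log (rho_pos c)]
  rw [Real.exp_add, h1, Real.exp_log (rho_pos c), mul_assoc]
  have h2 := Real.one_sub_inv_le_log_of_pos (rho_pos c)
  have h3 := rho_pow_mul c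
  have h4 : 0 < rho c ^ c := pow_pos (rho_pos c) c
  have h5 : rho c - 1 ≤ Real.log (rho c) * rho c := by
    have := mul_le_mul_of_nonneg_right h2 (rho_pos c).le
    rwa [sub_mul, inv_mul_cancel₀ (rho_pos c).ne', one_mul] at this
  have : 1 ≤ Real.log (rho c) * (rho c ^ c * rho c) := by nlinarith
  nlinarith [(Nat.cast_nonneg c : (0 : ℝ) ≤ c)]

theorem mul_log_rho_le_log {c : ℕ} (hc : 3 ≤ c) : c * Real.log (rho c) ≤ Real.log c := by
  have hc' : (3 : ℝ) ≤ c := by exact_mod_cast hc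
  -- For `y ≤ 1` the bound follows from `exp 1 < 3 ≤ c`; otherwise `exp y ≤ y * exp y ≤ c`.
  by_cases h : c * Real.log (rho c) ≤ 1
  · refine h.trans ?_
    rw [Real.le_log_iff_exp_le (by linarith)]
    linarith [Real.exp_one_lt_d9]
  · rw [Real.le_log_iff_exp_le (by linarith)]
    have := mul_log_rho_mul_exp_le c
    nlinarith [Real.exp_pos (c * Real.log (rho c))]

theorem log_sub_log_log_le {c : ℕ} (hc : 3 ≤ c) :
    Real.log c - Real.log (Real.log c) ≤ c * Real.log (rho c) * (1 + (c : ℝ)⁻¹) := by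
  have hc' : (3 : ℝ) ≤ c := by exact_mod_cast hc
  have hpos : 0 < c * Real.log (rho c) := mul_pos (by linarith) (log_rho_pos c)
  have h1 := Real.log_le_log (by linarith) (le_mul_log_rho_mul_exp c)
  rw [Real.log_mul hpos.ne' (Real.exp_pos _).ne', Real.log_exp] at h1
  have h2 := Real.log_le_log hpos (mul_log_rho_le_log hc)
  have h3 : c * Real.log (rho c) * (1 + (c : ℝ)⁻¹) = c * Real.log (rho c) + Real.log (rho c) := by
    field_simp
  linarith

theorem tendsto_mul_log_rho_div_log :
    Tendsto (fun c : ℕ => c * Real.log (rho c) / Real.log c) atTop (nhds 1) := by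
  have hlog : Tendsto (fun c : ℕ => Real.log c) atTop atTop :=
    Real.tendsto_log_atTop.comp tendsto_natCast_atTop_atTop
  have h1 : Tendsto (fun c : ℕ => Real.log (Real.log c) / Real.log c) atTop (nhds 0) :=
    (Real.isLittleO_log_id_atTop.tendsto_div_nhds_zero).comp hlog
  have h2 : Tendsto (fun c : ℕ => ((c : ℝ))⁻¹) atTop (nhds 0) := tendsto_inv_atTop_nhds_zero_nat
  have h3 : Tendsto (fun c : ℕ => (1 - Real.log (Real.log c) / Real.log c) / (1 + (c : ℝ)⁻¹)) atTop
      (nhds 1) := by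
    simpa [Pi.div_def] using (h1.const_sub 1).div (h2.const_add 1) (by norm_num)
  refine tendsto_of_tendsto_of_tendsto_of_le_of_le' h3 tendsto_const_nhds ?_ ?_
  · filter_upwards [eventually_ge_atTop 3] with c hc
    have hc' : (3 : ℝ) ≤ c := by exact_mod_cast hc
    have hl : 0 < Real.log c := Real.log_pos (by linarith)
    have hp : 0 < 1 + (c : ℝ)⁻¹ := by positivity
    have := log_sub_log_log_le hc
    rw [div_le_div_iff₀ hp hl, sub_mul, div_mul_cancel₀ _ hl.ne', one_mul]
    exact this
  · filter_upwards [eventually_ge_atTop 3] with c hc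
    have hc' : (3 : ℝ) ≤ c := by exact_mod_cast hc
    exact div_le_one_of_le₀ (mul_log_rho_le_log hc) (Real.log_nonneg (by linarith))

theorem log_rho_isEquivalent :
    IsEquivalent atTop (fun c : ℕ => Real.log (rho c)) fun c : ℕ => Real.log (c : ℝ) / (c : ℝ) := by
  refine isEquivalent_of_tendsto_one ?_
  refine tendsto_mul_log_rho_div_log.congr fun c => ?_
  simp only [Pi.div_apply]
  rw [div_div_eq_mul_div, mul_comm]

theorem two_mul_log_rho_pow_isEquivalent (α : ℕ → ℕ) :
    IsEquivalent atTop (fun c : ℕ => 2 * Real.log (rho c ^ α c))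
      (fun c : ℕ => 2 * (α c : ℝ) * (Real.log (c : ℝ) / (c : ℝ))) := by
  have := (IsEquivalent.refl (u := fun c : ℕ => 2 * (α c : ℝ)) (l := atTop)).mul
    log_rho_isEquivalent
  refine this.congr_left (Eventually.of_forall fun c => ?_)
  simp only [Pi.mul_apply, Real.log_pow]
  ring

/-! ### Counting admissible words -/

/-- Admissible words with `n` transitions which start at `i` and end in `E`. -/
def words (c : ℕ) (E : Finset (Fin (c + 1))) (n : ℕ) (i : Fin (c + 1)) :
    Finset (Fin (n + 1) → Fin (c + 1)) :=
  {w | w 0 = i ∧ (∀ k : Fin n, transition c (w k.castSucc) (w k.succ) = 1) ∧ w (Fin.last n) ∈ E}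

theorem transition_eq_one {c : ℕ} {i j : Fin (c + 1)} :
    transition c i j = 1 ↔ (i = 0 ∧ j = 0) ∨ j = i + 1 := by
  simp only [transition, Matrix.of_apply]
  split_ifs with h <;> simp [h]

theorem card_words_succ (c : ℕ) (E : Finset (Fin (c + 1))) (n : ℕ) (i : Fin (c + 1)) :
    (words c E (n + 1) i).card =
      ∑ j with transition c i j = 1, (words c E n j).card := by
  classical
  have h : words c E (n + 1) i = ({j | transition c i j = 1} : Finset (Fin (c + 1))).biUnion
      fun j => (words c E n j).image (Fin.cons (α := fun _ => Fin (c + 1)) i) := by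
    ext w
    simp only [words, Finset.mem_filter, Finset.mem_univ, true_and, Finset.mem_biUnion,
      Finset.mem_image]
    constructor
    · rintro ⟨h0, h1, h2⟩
      refine ⟨w 1, ?_, Fin.tail w, ⟨rfl, fun k => ?_, h2⟩, ?_⟩
      · have := h1 0
        rwa [Fin.castSucc_zero, h0] at this
      · exact h1 k.succ
      · rw [← h0, Fin.cons_self_tail]
    · rintro ⟨j, hj, u, ⟨h0, h1, h2⟩, rfl⟩
      refine ⟨rfl, fun k => ?_, ?_⟩
      · refine Fin.cases ?_ (fun k => ?_) k
        · simpa [h0] using hj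
        · rw [← Fin.succ_castSucc, Fin.cons_succ, Fin.cons_succ]
          exact h1 k
      · rwa [← Fin.succ_last, Fin.cons_succ]
  rw [h, Finset.card_biUnion]
  · refine Finset.sum_congr rfl fun j _ => Finset.card_image_of_injective _ ?_
    exact Fin.cons_right_injective (α := fun _ => Fin (c + 1)) i
  · intro j _ j' _ hjj'
    rw [Function.onFun, Finset.disjoint_left]
    intro w hw hw'
    obtain ⟨u, hu, rfl⟩ := Finset.mem_image.1 hw
    obtain ⟨u', hu', heq⟩ := Finset.mem_image.1 hw'
    obtain rfl := Fin.cons_right_injective (α := fun _ => Fin (c + 1)) i heq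
    simp only [words, Finset.mem_filter] at hu hu'
    exact hjj' (hu.2.1.symm.trans hu'.2.1)

theorem val_one_of_pos {c : ℕ} (hc : 1 ≤ c) : (1 : Fin (c + 1)).val = 1 :=
  Nat.mod_eq_of_lt (show 1 < c + 1 by omega)

theorem sum_transition_zero {c : ℕ} (hc : 1 ≤ c) {M : Type*} [AddCommMonoid M]
    (g : Fin (c + 1) → M) : ∑ j with transition c 0 j = 1, g j = g 0 + g 1 := by
  have h01 : (0 : Fin (c + 1)) ≠ 1 := by
    intro h
    have := congrArg Fin.val h
    rw [val_one_of_pos hc] at this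
    simp at this
  rw [← Finset.sum_pair h01]
  congr 1
  ext j
  simp [transition_eq_one]

theorem sum_transition_of_ne {c : ℕ} {i : Fin (c + 1)} (hi : i ≠ 0) {M : Type*} [AddCommMonoid M]
    (g : Fin (c + 1) → M) : ∑ j with transition c i j = 1, g j = g (i + 1) := by
  rw [← Finset.sum_singleton g (i + 1)]
  congr 1
  ext j
  simp [transition_eq_one, hi]

/-- The positive eigenvector of the transition matrix for the eigenvalue `rho c`. -/
noncomputable def weight (c : ℕ) (i : Fin (c + 1)) : ℝ :=
  if i = 0 then 1 else rho c ^ (i : ℕ) / rho c ^ (c + 1)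

/-- Off `0` the weights are geometric, with `c` leading back to `0`; at `0` the identity is the
equation of `rho`. -/
theorem sum_weight {c : ℕ} (hc : 1 ≤ c) (i : Fin (c + 1)) :
    ∑ j with transition c i j = 1, weight c j = rho c * weight c i := by
  have hr := rho_pos c
  by_cases hi : i = 0
  · subst hi
    rw [sum_transition_zero hc]
    have h1 := val_one_of_pos hc
    have h10 : (1 : Fin (c + 1)) ≠ 0 := fun h => by simp [h] at h1
    simp only [weight, if_pos, if_neg h10, h1, pow_one]
    have := rho_pow_mul c
    rw [pow_succ]
    field_simp
    linarith
  · rw [sum_transition_of_ne hi]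
    simp only [weight, if_neg hi]
    by_cases hl : i = Fin.last c
    · subst hl
      simp only [Fin.last_add_one, if_pos, Fin.val_last]
      rw [pow_succ]
      field_simp
    · have hv := Fin.val_add_one_of_lt (Fin.lt_last_iff_ne_last.2 hl)
      have hne : i + 1 ≠ 0 := fun h => by simp [h] at hv
      rw [if_neg hne, hv, pow_succ]
      ring

theorem weight_le_one (c : ℕ) (i : Fin (c + 1)) : weight c i ≤ 1 := by
  unfold weight
  split_ifs
  · rfl
  · exact div_le_one_of_le₀ (pow_le_pow_right₀ (one_lt_rho c).le i.2.le) (pow_pos (rho_pos c) _).le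

theorem one_le_rho_pow_mul_weight (c : ℕ) (i : Fin (c + 1)) : 1 ≤ rho c ^ c * weight c i := by
  unfold weight
  have hr := rho_pos c
  split_ifs with h
  · rw [mul_one]; exact one_le_pow₀ (one_lt_rho c).le
  · have h1 : 1 ≤ (i : ℕ) := by
      rcases Nat.eq_zero_or_pos (i : ℕ) with h' | h'
      · exact absurd (Fin.ext h') h
      · exact h'
    rw [pow_succ, mul_div_assoc', mul_div_mul_left _ _ (pow_pos hr c).ne', le_div_iff₀ hr, one_mul]
    exact le_self_pow₀ (one_lt_rho c).le (by omega)

theorem card_words_le {c : ℕ} (hc : 1 ≤ c) (E : Finset (Fin (c + 1))) (n : ℕ) (i : Fin (c + 1)) :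
    ((words c E n i).card : ℝ) ≤ rho c ^ c * weight c i * rho c ^ n := by
  induction n generalizing i with
  | zero =>
    have : (words c E 0 i).card ≤ 1 := by
      rw [Finset.card_le_one]
      intro a ha b hb
      simp only [words, Finset.mem_filter] at ha hb
      ext k : 1
      rw [show k = 0 from Fin.ext (by omega), ha.2.1, hb.2.1]
    rw [pow_zero, mul_one]
    exact le_trans (by exact_mod_cast this) (one_le_rho_pow_mul_weight c i)
  | succ n ih =>
    rw [card_words_succ]
    push_cast
    refine (Finset.sum_le_sum fun j _ => ih j).trans ?_
    rw [← Finset.sum_mul, ← Finset.mul_sum, sum_weight hc, pow_succ]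
    apply le_of_eq; ring

theorem sum_card_words_le {c : ℕ} (hc : 1 ≤ c) (n : ℕ) :
    ((∑ i, (words c Finset.univ n i).card : ℕ) : ℝ) ≤ (c + 1) * rho c ^ c * rho c ^ n := by
  have h : ∀ i ∈ (Finset.univ : Finset (Fin (c + 1))),
      ((words c Finset.univ n i).card : ℝ) ≤ rho c ^ c * rho c ^ n := fun i _ => by
    refine (card_words_le hc _ n i).trans ?_
    have := weight_le_one c i
    have h1 := pow_pos (rho_pos c) c
    have h2 := pow_pos (rho_pos c) n
    gcongr
    nlinarith
  push_cast
  refine (Finset.sum_le_sum h).trans ?_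
  simp [mul_assoc]

/-- The path `i, i + 1, …, c, 0` has `c + 1 - i` transitions and can then rest at `0`. -/
theorem one_le_card_words_zero {c : ℕ} (hc : 1 ≤ c) (n : ℕ) (i : Fin (c + 1))
    (h : i = 0 ∨ c + 1 ≤ n + i) : 1 ≤ (words c {0} n i).card := by
  induction n generalizing i with
  | zero =>
    have hi : i = 0 := by
      rcases h with h | h
      · exact h
      · have := i.2; omega
    refine Finset.card_pos.2 ⟨fun _ => 0, ?_⟩
    simp [words, hi]
  | succ n ih =>
    rw [card_words_succ]
    by_cases hi : i = 0
    · subst hi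
      rw [sum_transition_zero hc]
      exact (ih 0 (Or.inl rfl)).trans (Nat.le_add_right _ _)
    · rw [sum_transition_of_ne hi]
      apply ih
      by_cases hl : i = Fin.last c
      · left; rw [hl, Fin.last_add_one]
      · right
        rw [Fin.val_add_one_of_lt (Fin.lt_last_iff_ne_last.2 hl)]
        rcases h with h | h
        · exact absurd h hi
        · omega

/-- The `c` extra transitions let every starting state reach `0`, which gives the base case; the
eigenvector relation propagates it. -/
theorem le_card_words_zero {c : ℕ} (hc : 1 ≤ c) (n : ℕ) (i : Fin (c + 1)) :
    weight c i * rho c ^ n ≤ (words c {0} (c + n) i).card := by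
  induction n generalizing i with
  | zero =>
    rw [pow_zero, mul_one]
    refine (weight_le_one c i).trans ?_
    have := one_le_card_words_zero hc (c + 0) i (by
      by_cases hi : i = 0
      · exact Or.inl hi
      · right
        have : (i : ℕ) ≠ 0 := fun h => hi (Fin.ext h)
        omega)
    exact_mod_cast this
  | succ n ih =>
    rw [← add_assoc, card_words_succ]
    push_cast
    refine le_trans ?_ (Finset.sum_le_sum fun j _ => ih j)
    rw [← Finset.sum_mul, sum_weight hc, pow_succ]
    apply le_of_eq; ring

/-! ### Upper bound -/

theorem T_congr {e r : ℕ} {x y : ℤ → Fin (e + r + 1)} {n m : ℕ}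
    (h : ∀ j : ℤ, |j| ≤ (m + n : ℕ) → x j = y j) (j : ℤ) (hj : |j| ≤ m) :
    (T e r)^[n] x j = (T e r)^[n] y j := by
  induction n generalizing x y with
  | zero => exact h j (by simpa using hj)
  | succ n ih =>
    rw [Function.iterate_succ_apply, Function.iterate_succ_apply]
    refine ih fun k hk => ?_
    have hk' := abs_le.1 hk
    push_cast at hk'
    simp only [T]
    rw [h k (abs_le.2 (by push_cast; omega)), h (k + 1) (abs_le.2 (by push_cast; omega)),
      h (k - 1) (abs_le.2 (by push_cast; omega))]

/-- The configuration with the word `u` read leftwards from `p` and the word `v` read rightwards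
from `p + 1`. -/
def glueWords {A : Type} {a b : ℕ} (p : ℤ) (u : Fin (a + 1) → A) (v : Fin (b + 1) → A) : ℤ → A :=
  fun j => if j ≤ p then u (Fin.ofNat (a + 1) (p - j).toNat)
    else v (Fin.ofNat (b + 1) (j - p - 1).toNat)

theorem exists_split_of_mem_Z {c : ℕ} {x : ℤ → Fin (c + 1)} (hx : x ∈ Z c) (K : ℕ) :
    ∃ q ≤ 2 * K, (∀ i : ℤ, -K < i → i ≤ q - K → transition c (x i) (x (i - 1)) = 1) ∧
      ∀ i : ℤ, q - K + 1 ≤ i → i ≤ K → transition c (x i) (x (i + 1)) = 1 := by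
  have key : ∀ p : ℤ, RightMovingUpTo x p → LeftMovingFrom x (p + 1) →
      ∃ q ≤ 2 * K, (∀ i : ℤ, -K < i → i ≤ q - K → transition c (x i) (x (i - 1)) = 1) ∧
      ∀ i : ℤ, q - K + 1 ≤ i → i ≤ K → transition c (x i) (x (i + 1)) = 1 := by
    intro p h1 h2
    -- `q - K` is `p` clamped to `[-K, K]`: `toNat` truncates below and `min` above.
    refine ⟨min (p + K).toNat (2 * K), min_le_right _ _, fun i hi hi' => h1 i ?_,
      fun i hi hi' => h2 i ?_⟩
    · push_cast at hi'; omega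
    · push_cast at hi; omega
  rcases hx with (hx | hx) | ⟨⟨⟨p, hp1, hp2⟩, -⟩, -⟩
  · refine ⟨2 * K, le_rfl, fun i _ _ => hx i, fun i hi hi' => ?_⟩
    push_cast at hi; omega
  · refine ⟨0, Nat.zero_le _, fun i hi hi' => ?_, fun i _ _ => hx i⟩
    push_cast at hi'; omega
  · exact key p hp1 hp2

/-- All admissible words with `n` transitions. -/
def allWords (c n : ℕ) : Finset (Fin (n + 1) → Fin (c + 1)) :=
  Finset.univ.biUnion fun i => words c Finset.univ n i

theorem mem_allWords {c n : ℕ} {w : Fin (n + 1) → Fin (c + 1)} :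
    w ∈ allWords c n ↔ ∀ k : Fin n, transition c (w k.castSucc) (w k.succ) = 1 := by
  simp [allWords, words]

theorem card_allWords_le {c : ℕ} (hc : 1 ≤ c) (n : ℕ) :
    ((allWords c n).card : ℝ) ≤ (c + 1) * rho c ^ c * rho c ^ n :=
  (Nat.cast_le.2 Finset.card_biUnion_le).trans (sum_card_words_le hc n)

open Classical in
/-- A finite set of configurations that realizes all patterns of `Z c` on `[-K, K + 1]`. -/
noncomputable def patterns (c K : ℕ) : Finset (ℤ → Fin (c + 1)) :=
  (Finset.range (2 * K + 1)).biUnion fun q =>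
    (allWords c q ×ˢ allWords c (2 * K - q)).image fun w => glueWords ((q : ℤ) - K) w.1 w.2

/-- The two words have `q` and `2 * K - q` transitions, so every split contributes the same power
`rho ^ (2 * K)`. -/
theorem card_patterns_le {c : ℕ} (hc : 1 ≤ c) (K : ℕ) :
    ((patterns c K).card : ℝ) ≤ (2 * K + 1) * (((c + 1) * rho c ^ c) ^ 2 * rho c ^ (2 * K)) := by
  classical
  have h : ∀ q ∈ Finset.range (2 * K + 1),
      ((((allWords c q ×ˢ allWords c (2 * K - q)).image
        fun w => glueWords ((q : ℤ) - K) w.1 w.2).card : ℕ) : ℝ) ≤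
        ((c + 1) * rho c ^ c) ^ 2 * rho c ^ (2 * K) := by
    intro q hq
    refine (Nat.cast_le.2 Finset.card_image_le).trans ?_
    rw [Finset.card_product]
    push_cast
    have hr := rho_pos c
    refine (mul_le_mul (card_allWords_le hc q) (card_allWords_le hc (2 * K - q)) (by positivity)
      (by positivity)).trans (le_of_eq ?_)
    rw [show 2 * K = q + (2 * K - q) by rw [Finset.mem_range] at hq; omega, Nat.add_sub_cancel_left,
      pow_add]
    ring
  unfold patterns
  refine (Nat.cast_le.2 Finset.card_biUnion_le).trans ?_
  push_cast
  refine (Finset.sum_le_sum fun q hq => le_trans (le_of_eq ?_) (h q hq)).trans (le_of_eq ?_)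
  · congr!
  rw [Finset.sum_const, Finset.card_range, nsmul_eq_mul]
  push_cast; ring

theorem exists_mem_patterns {c : ℕ} {x : ℤ → Fin (c + 1)} (hx : x ∈ Z c) (K : ℕ) :
    ∃ y ∈ patterns c K, ∀ j : ℤ, |j| ≤ K → x j = y j := by
  classical
  obtain ⟨q, hq, h1, h2⟩ := exists_split_of_mem_Z hx K
  refine ⟨glueWords ((q : ℤ) - K) (fun k : Fin (q + 1) => x (q - K - (k : ℕ)))
    (fun k : Fin (2 * K - q + 1) => x (q - K + 1 + (k : ℕ))), ?_, ?_⟩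
  · unfold patterns
    refine Finset.mem_biUnion.2 ⟨q, Finset.mem_range.2 (by omega), Finset.mem_image.2
      ⟨(_, _), Finset.mem_product.2 ⟨mem_allWords.2 fun k => ?_, mem_allWords.2 fun k => ?_⟩, rfl⟩⟩
    · have := h1 (q - K - (k : ℕ)) (by have := k.2; omega) (by omega)
      convert this using 3
      · rw [Fin.val_castSucc]
      · rw [Fin.val_succ]; push_cast; ring
    · have := h2 (q - K + 1 + (k : ℕ)) (by omega) (by have := k.2; omega)
      convert this using 3
      · rw [Fin.val_castSucc]
      · rw [Fin.val_succ]; push_cast; ring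
  · intro j hj
    have hj := abs_le.1 hj
    unfold glueWords
    split_ifs with h
    · simp only [Fin.val_ofNat]
      rw [Nat.mod_eq_of_lt (by omega)]
      congr 1; omega
    · simp only [Fin.val_ofNat]
      rw [Nat.mod_eq_of_lt (by omega)]
      congr 1; omega

theorem topEntropy_Z_le {e r : ℕ} (hc : 1 ≤ e + r) (a : ℕ) :
    topEntropy ((T e r)^[a]) (Z (e + r)) ≤ (2 * Real.log (rho (e + r) ^ a) : ℝ) := by
  set ρ := rho (e + r) with hρ
  have hr : 0 < ρ := rho_pos _
  refine le_coe_of_forall_gt fun b hb => topEntropy_le fun m => ?_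
  set C := (((e + r : ℕ) + 1 : ℝ) * ρ ^ (e + r)) ^ 2 * ρ ^ (2 * m) with hC
  -- With `K = m + a * n`, the number `2 * K + 1` of splits is affine in `n`.
  filter_upwards [eventually_affine_mul_exp_le ((2 * m + 1) * C) (2 * a * C) hb] with n hn
  refine ⟨patterns (e + r) (m + a * n), ?_, fun x hx => ?_⟩
  · refine (card_patterns_le hc _).trans (le_trans (le_of_eq ?_) hn)
    have : Real.exp (2 * Real.log (ρ ^ a) * n) = ρ ^ (2 * (a * n)) := by
      rw [Real.log_pow, show 2 * (a * Real.log ρ) * n = ((2 * (a * n) : ℕ) : ℝ) * Real.log ρ by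
        push_cast; ring, Real.exp_nat_mul, Real.exp_log hr]
    rw [this, hC, ← hρ, mul_add 2 m, pow_add]
    push_cast
    ring
  · obtain ⟨y, hy, hxy⟩ := exists_mem_patterns hx (m + a * n)
    refine ⟨y, hy, fun k hk j hj => ?_⟩
    rw [← Function.iterate_mul]
    refine T_congr (fun i hi => hxy i (hi.trans ?_)) j hj
    exact_mod_cast Nat.add_le_add_left (Nat.mul_le_mul_left a hk.le) m

/-! ### Dynamics of lifts -/

theorem add_one_mod (n d : ℕ) :
    (n + 1) % (d + 1) = if n % (d + 1) = d then 0 else n % (d + 1) + 1 := by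
  have h := Nat.mod_lt n (show 0 < d + 1 from Nat.succ_pos d)
  rw [← Nat.mod_add_mod]
  split_ifs with h'
  · rw [h', Nat.mod_self]
  · exact Nat.mod_eq_of_lt (by omega)

/-- A height function whose residues modulo `c + 1` form a configuration in which every cell that
is not at rest has a neighbour one step ahead. -/
structure IsLift (c : ℕ) (f : ℤ → ℕ) : Prop where
  succ_le : ∀ k, f (k + 1) ≤ f k + 1
  le_succ : ∀ k, f k ≤ f (k + 1) + 1
  ahead : ∀ k, f k % (c + 1) ≠ 0 → f (k + 1) = f k + 1 ∨ f (k - 1) = f k + 1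

/-- The configuration of residues of a height function. -/
def ofHeight (c : ℕ) (f : ℤ → ℕ) : ℤ → Fin (c + 1) := fun k => Fin.ofNat (c + 1) (f k)

/-- The maximum of a height function over a cell and its neighbours. -/
def maxStep (f : ℤ → ℕ) : ℤ → ℕ := fun k => max (f k) (max (f (k + 1)) (f (k - 1)))

/-- If the new height at `k` has nonzero residue, it is attained at a neighbour whose own cell ahead
lies on the far side from `k`. That neighbour therefore rises too and stays one ahead of `k`. -/
theorem IsLift.maxStep {c : ℕ} {f : ℤ → ℕ} (h : IsLift c f) : IsLift c (maxStep f) := by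
  have e1 : ∀ k : ℤ, k - 1 + 1 = k := fun k => by ring
  have e2 : ∀ k : ℤ, k + 1 - 1 = k := fun k => by ring
  refine ⟨fun k => ?_, fun k => ?_, fun k hk => ?_⟩
  · have h1 := h.succ_le k
    have h2 := h.succ_le (k + 1)
    simp only [GreenbergHastings.maxStep, e2]
    omega
  · have h1 := h.le_succ k
    have h2 := h.le_succ (k - 1)
    rw [e1] at h2
    simp only [GreenbergHastings.maxStep, e2]
    omega
  · have a1 := h.succ_le k
    have a2 := h.succ_le (k + 1)
    have a3 := h.le_succ k
    have a4 := h.le_succ (k - 1)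
    have a5 := h.le_succ (k - 1 - 1)
    have b1 := h.ahead k
    have b2 := h.ahead (k + 1)
    have b3 := h.ahead (k - 1)
    rw [e1] at a4 a5 b3
    rw [e2] at b2
    simp only [GreenbergHastings.maxStep, e1, e2] at hk ⊢
    rcases max_choice (f k) (max (f (k + 1)) (f (k - 1))) with hm | hm
    · rw [hm] at hk
      have := b1 hk
      omega
    · rcases max_choice (f (k + 1)) (f (k - 1)) with hm' | hm'
      · rw [hm, hm'] at hk
        have := b2 hk
        omega
      · rw [hm, hm'] at hk
        have := b3 hk
        omega

/-- Next to a resting cell only the residues `0`, `1`, `c` occur. As `1 ≤ e < c`, the excited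
neighbours are exactly those one ahead. A cell not at rest always has a neighbour ahead, so the
maximum raises it by one, as the reaction does. -/
theorem T_ofHeight {e r : ℕ} (he : 1 ≤ e) (hr : 1 ≤ r) {f : ℤ → ℕ} (h : IsLift (e + r) f) :
    T e r (ofHeight (e + r) f) = ofHeight (e + r) (maxStep f) := by
  funext k
  have a1 := h.succ_le k
  have a2 := h.le_succ k
  have a3 := h.succ_le (k - 1)
  have a4 := h.le_succ (k - 1)
  rw [sub_add_cancel] at a3 a4
  have b := h.ahead k
  have hlt := Nat.mod_lt (f k) (show 0 < e + r + 1 from Nat.succ_pos _)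
  have hs := add_one_mod (f k) (e + r)
  have hv : (ofHeight (e + r) f k).val = f k % (e + r + 1) := rfl
  by_cases h0 : f k % (e + r + 1) = 0
  · have hk0 : ofHeight (e + r) f k = 0 := Fin.ext (by rw [hv, h0]; rfl)
    have hre : reaction e r 0 = 0 := by simp [reaction]
    have hexc : ∀ i : ℤ, f i ≤ f k + 1 → f k ≤ f i + 1 →
        ((1 ≤ (ofHeight (e + r) f i).val ∧ (ofHeight (e + r) f i).val ≤ e) ↔ f i = f k + 1) := by
      intro i h1 h2
      change (1 ≤ f i % (e + r + 1) ∧ f i % (e + r + 1) ≤ e) ↔ _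
      rcases (by omega : f i = f k + 1 ∨ f i = f k ∨ f i + 1 = f k) with h3 | h3 | h3
      · rw [h3, hs, if_neg (by omega)]; omega
      · rw [h3]; omega
      · have hs' := add_one_mod (f i) (e + r)
        rw [h3, h0] at hs'
        split_ifs at hs' with h4
        omega
    simp only [T, interaction, hk0, hre, true_and, zero_add, hexc (k + 1) a1 a2, hexc (k - 1) a4 a3]
    apply Fin.ext
    simp only [ofHeight, Fin.val_ofNat, maxStep]
    split_ifs with h3
    · rw [val_one_of_pos (by omega), show max (f k) (max (f (k + 1)) (f (k - 1))) = f k + 1 by omega,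
        hs, if_neg (by omega), h0]
    · rw [show max (f k) (max (f (k + 1)) (f (k - 1))) = f k by omega, h0]
      rfl
  · have hk0 : ofHeight (e + r) f k ≠ 0 := fun h => h0 (by rw [← hv, h]; rfl)
    have hint : ∀ u v, interaction e r (ofHeight (e + r) f k) u v = 0 := fun u v => by
      simp [interaction, hk0]
    have hb := b h0
    simp only [T, hint, add_zero]
    apply Fin.ext
    simp only [ofHeight, Fin.val_ofNat, maxStep]
    rw [show max (f k) (max (f (k + 1)) (f (k - 1))) = f k + 1 by omega, hs]
    unfold reaction
    simp only [Fin.val_ofNat]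
    split_ifs with h1 h2 h2
    · omega
    · rfl
    · rfl
    · omega

theorem T_iterate_ofHeight {e r : ℕ} (he : 1 ≤ e) (hr : 1 ≤ r) {f : ℤ → ℕ} (h : IsLift (e + r) f)
    (t : ℕ) : (T e r)^[t] (ofHeight (e + r) f) = ofHeight (e + r) (maxStep^[t] f) := by
  induction t generalizing f with
  | zero => rfl
  | succ t ih =>
    rw [Function.iterate_succ_apply, Function.iterate_succ_apply, T_ofHeight he hr h, ih h.maxStep]

theorem maxStep_iterate_le (f : ℤ → ℕ) (t : ℕ) (k : ℤ) (b : ℕ) :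
    maxStep^[t] f k ≤ b ↔ ∀ j, |j - k| ≤ t → f j ≤ b := by
  induction t generalizing k with
  | zero =>
    simp only [Function.iterate_zero, id, Nat.cast_zero, abs_nonpos_iff, sub_eq_zero, forall_eq]
  | succ t ih =>
    rw [Function.iterate_succ_apply']
    simp only [maxStep, max_le_iff, ih]
    simp only [abs_le]
    push_cast
    constructor
    · rintro ⟨h1, h2, h3⟩ j hj
      rcases (by omega : (-(t : ℤ) ≤ j - k ∧ j - k ≤ t) ∨
        (-(t : ℤ) ≤ j - (k + 1) ∧ j - (k + 1) ≤ t) ∨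
        (-(t : ℤ) ≤ j - (k - 1) ∧ j - (k - 1) ≤ t)) with h | h | h
      exacts [h1 j h, h2 j h, h3 j h]
    · intro h
      exact ⟨fun j hj => h j (by omega), fun j hj => h j (by omega), fun j hj => h j (by omega)⟩

theorem maxStep_iterate_eq {f : ℤ → ℕ} {t : ℕ} {k j : ℤ} (hj : |j - k| ≤ t)
    (h : ∀ i, |i - k| ≤ t → f i ≤ f j) : maxStep^[t] f k = f j :=
  le_antisymm ((maxStep_iterate_le f t k _).2 h) ((maxStep_iterate_le f t k _).1 le_rfl j hj)

/-! ### Colliding half-line configurations -/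

/-- Heights along a half-line multi-pulse that starts at rest. -/
structure IsHalfLift (c : ℕ) (h : ℕ → ℕ) : Prop where
  zero : h 0 = 0
  step : ∀ n, h (n + 1) = h n ∨ h (n + 1) = h n + 1
  ahead : ∀ n, h n % (c + 1) ≠ 0 → h (n + 1) = h n + 1

theorem IsHalfLift.monotone {c : ℕ} {h : ℕ → ℕ} (hh : IsHalfLift c h) : Monotone h :=
  monotone_nat_of_le_succ fun n => by have := hh.step n; omega

/-- The height function on `ℤ` with heights `hR` to the right and `hL` to the left of `0`. -/
def joinHeights (hR hL : ℕ → ℕ) : ℤ → ℕ :=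
  fun j => if 0 ≤ j then hR j.toNat else hL (-j).toNat

theorem joinHeights_natCast (hR hL : ℕ → ℕ) (n : ℕ) : joinHeights hR hL n = hR n := by
  simp [joinHeights]

theorem joinHeights_neg_natCast {c : ℕ} {hR hL : ℕ → ℕ} (h1 : IsHalfLift c hR)
    (h2 : IsHalfLift c hL) (n : ℕ) : joinHeights hR hL (-n) = hL n := by
  rcases Nat.eq_zero_or_pos n with rfl | hn
  · simp [joinHeights, h1.zero, h2.zero]
  · rw [joinHeights, if_neg (by omega)]
    congr 1; omega

theorem exists_nat_or_neg_succ (k : ℤ) : ∃ n : ℕ, k = n ∨ (k = -((n + 1 : ℕ) : ℤ)) := by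
  rcases le_or_gt 0 k with h | h
  · exact ⟨k.toNat, Or.inl (by omega)⟩
  · exact ⟨(-k - 1).toNat, Or.inr (by omega)⟩

theorem IsHalfLift.isLift_joinHeights {c : ℕ} {hR hL : ℕ → ℕ} (h1 : IsHalfLift c hR)
    (h2 : IsHalfLift c hL) : IsLift c (joinHeights hR hL) := by
  have eR := joinHeights_natCast hR hL
  have eL := joinHeights_neg_natCast h1 h2
  have e1 : ∀ n : ℕ, ((n : ℤ) + 1) = ((n + 1 : ℕ) : ℤ) := fun n => by push_cast; rfl
  have e2 : ∀ n : ℕ, (-((n + 1 : ℕ) : ℤ) + 1) = -(n : ℤ) := fun n => by push_cast; ring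
  have e3 : ∀ n : ℕ, (-(n : ℤ) - 1) = -((n + 1 : ℕ) : ℤ) := fun n => by push_cast; ring
  refine ⟨fun k => ?_, fun k => ?_, fun k hk => ?_⟩
  · obtain ⟨n, rfl | rfl⟩ := exists_nat_or_neg_succ k
    · rw [e1, eR, eR]; have := h1.step n; omega
    · rw [e2, eL, eL]; have := h2.step n; omega
  · obtain ⟨n, rfl | rfl⟩ := exists_nat_or_neg_succ k
    · rw [e1, eR, eR]; have := h1.step n; omega
    · rw [e2, eL, eL]; have := h2.step n; omega
  · obtain ⟨n, rfl | rfl⟩ := exists_nat_or_neg_succ k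
    · rw [eR] at hk
      rw [e1, eR, eR]; exact Or.inl (h1.ahead n hk)
    · rw [eL] at hk
      rw [e3, eL, eL]; exact Or.inr (h2.ahead _ hk)

theorem transition_ofNat {c u v : ℕ} (h : v = u ∨ v = u + 1) (h' : u % (c + 1) ≠ 0 → v = u + 1) :
    transition c (Fin.ofNat (c + 1) u) (Fin.ofNat (c + 1) v) = 1 := by
  rw [transition_eq_one]
  by_cases hv : v = u + 1
  · right
    subst hv
    apply Fin.ext
    rw [Fin.val_add]
    change (u + 1) % (c + 1) = (u % (c + 1) + 1 % (c + 1)) % (c + 1)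
    rw [Nat.add_mod]
  · left
    have hu : u % (c + 1) = 0 := by by_contra hu; exact hv (h' hu)
    obtain rfl : v = u := by omega
    exact ⟨Fin.ext hu, Fin.ext hu⟩

/-- Unbounded separating positions would put `x` in `SR`. Otherwise the largest one is at least `0`,
so `x` is left-moving from it as well. -/
theorem mem_Z_of_movingFrom_zero {c : ℕ} {x : ℤ → Fin (c + 1)} (hr : RightMovingUpTo x 0)
    (hl : LeftMovingFrom x 0) : x ∈ Z c := by
  by_cases hx : x ∈ SR c ∪ SL c
  · exact Or.inl hx
  · have h0 : (0 : ℤ) ∈ separatingPositions x := ⟨hr, fun i hi => hl i (by omega)⟩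
    have hbdd : BddAbove (separatingPositions x) := by
      by_contra hb
      refine hx (Or.inl fun i => ?_)
      rw [not_bddAbove_iff] at hb
      obtain ⟨p, hp, hip⟩ := hb i
      exact hp.1 i hip.le
    have hmem := Int.csSup_mem ⟨0, h0⟩ hbdd
    have hle := le_csSup hbdd h0
    refine Or.inr ⟨⟨⟨0, h0⟩, hx⟩, sSup (separatingPositions x), ⟨hmem, fun p hp => le_csSup hbdd hp⟩,
      Or.inr ⟨hmem.1, fun i hi => hl i (hle.trans hi)⟩⟩

theorem ofHeight_joinHeights_mem_Z {c : ℕ} {hR hL : ℕ → ℕ} (h1 : IsHalfLift c hR)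
    (h2 : IsHalfLift c hL) : ofHeight c (joinHeights hR hL) ∈ Z c := by
  refine mem_Z_of_movingFrom_zero (fun i hi => ?_) fun i hi => ?_
  · obtain ⟨n, rfl⟩ : ∃ n : ℕ, i = -(n : ℤ) := ⟨(-i).toNat, by omega⟩
    unfold ofHeight
    rw [show (-(n : ℤ) - 1) = -((n + 1 : ℕ) : ℤ) by push_cast; ring,
      joinHeights_neg_natCast h1 h2, joinHeights_neg_natCast h1 h2]
    exact transition_ofNat (h2.step n) (h2.ahead n)
  · obtain ⟨n, rfl⟩ : ∃ n : ℕ, i = (n : ℤ) := ⟨i.toNat, by omega⟩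
    unfold ofHeight
    rw [show ((n : ℤ) + 1) = ((n + 1 : ℕ) : ℤ) by push_cast; ring,
      joinHeights_natCast, joinHeights_natCast]
    exact transition_ofNat (h1.step n) (h1.ahead n)

/-- The left half enters the range of the maximum only to depth `t - s`, and `N ≤ s` absorbs the
delay: `hL (t - s) ≤ hR (t - s + N) ≤ hR (t + s)`. -/
theorem maxStep_joinHeights_right {c : ℕ} {hR hL : ℕ → ℕ} (h1 : IsHalfLift c hR)
    (h2 : IsHalfLift c hL) {N : ℕ} (hN : ∀ t, hL t ≤ hR (t + N)) (t : ℕ) {s : ℕ} (hs : N ≤ s) :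
    maxStep^[t] (joinHeights hR hL) s = hR (t + s) := by
  rw [← joinHeights_natCast hR hL (t + s)]
  refine maxStep_iterate_eq (by push_cast; simp) fun i hi => ?_
  rw [joinHeights_natCast]
  have hi := abs_le.1 hi
  obtain ⟨n, rfl | rfl⟩ := exists_nat_or_neg_succ i
  · rw [joinHeights_natCast]
    exact h1.monotone (by omega)
  · rw [joinHeights_neg_natCast h1 h2]
    exact (hN _).trans (h1.monotone (by omega))

theorem maxStep_joinHeights_left {c : ℕ} {hR hL : ℕ → ℕ} (h1 : IsHalfLift c hR)
    (h2 : IsHalfLift c hL) {N : ℕ} (hN : ∀ t, hR t ≤ hL (t + N)) (t : ℕ) {s : ℕ} (hs : N ≤ s) :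
    maxStep^[t] (joinHeights hR hL) (-s) = hL (t + s) := by
  rw [← joinHeights_neg_natCast h1 h2 (t + s)]
  refine maxStep_iterate_eq (by push_cast; rw [abs_le]; omega) fun i hi => ?_
  rw [joinHeights_neg_natCast h1 h2]
  have hi := abs_le.1 hi
  obtain ⟨n, rfl | rfl⟩ := exists_nat_or_neg_succ i
  · rw [joinHeights_natCast]
    exact (hN _).trans (h2.monotone (by omega))
  · rw [joinHeights_neg_natCast h1 h2]
    exact h2.monotone (by omega)

/-! ### Concatenation of loops -/

/-- The height difference of a transition. -/
def rise {c : ℕ} (i j : Fin (c + 1)) : ℕ := if i = 0 ∧ j = 0 then 0 else 1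

/-- The height difference between the two ends of a word. -/
def wordHeight {c N : ℕ} (w : Fin (N + 1) → Fin (c + 1)) : ℕ :=
  ∑ k : Fin N, rise (w k.castSucc) (w k.succ)

/-- Admissible words from `0` to `0` with `N` transitions and height `H`. -/
def loops (c N H : ℕ) : Finset (Fin (N + 1) → Fin (c + 1)) :=
  {w ∈ words c {0} N 0 | wordHeight w = H}

/-- The concatenation of a sequence of words with `N` transitions. -/
def concat {c N : ℕ} (w : ℕ → Fin (N + 1) → Fin (c + 1)) (n : ℕ) : Fin (c + 1) :=
  -- The last letter of each word is dropped; for loops it is the `0` that begins the next word.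
  w (n / N) (Fin.ofNat (N + 1) (n % N))

/-- The heights along a sequence of states. -/
def heights {c : ℕ} (R : ℕ → Fin (c + 1)) (n : ℕ) : ℕ :=
  ∑ l ∈ Finset.range n, rise (R l) (R (l + 1))

theorem heights_succ {c : ℕ} (R : ℕ → Fin (c + 1)) (n : ℕ) :
    heights R (n + 1) = heights R n + rise (R n) (R (n + 1)) := Finset.sum_range_succ _ _

theorem ofNat_heights {c : ℕ} {R : ℕ → Fin (c + 1)} (h0 : R 0 = 0)
    (h : ∀ n, transition c (R n) (R (n + 1)) = 1) (n : ℕ) :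
    Fin.ofNat (c + 1) (heights R n) = R n := by
  induction n with
  | zero => rw [h0]; rfl
  | succ n ih =>
    have hn := transition_eq_one.1 (h n)
    rw [heights_succ, rise]
    split_ifs with hz
    · rw [add_zero, ih, hz.1, hz.2]
    · rw [hn.resolve_left hz, ← ih]
      apply Fin.ext
      rw [Fin.val_add]
      change (heights R n + 1) % (c + 1) = (heights R n % (c + 1) + 1 % (c + 1)) % (c + 1)
      rw [Nat.add_mod]

theorem isHalfLift_heights {c : ℕ} {R : ℕ → Fin (c + 1)} (h0 : R 0 = 0)
    (h : ∀ n, transition c (R n) (R (n + 1)) = 1) : IsHalfLift c (heights R) := by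
  refine ⟨rfl, fun n => ?_, fun n hn => ?_⟩
  · rw [heights_succ, rise]
    split_ifs <;> simp
  · rw [heights_succ, rise, if_neg]
    rintro ⟨hz, -⟩
    rw [← ofNat_heights h0 h n] at hz
    exact hn (congrArg Fin.val hz)

section Concat

variable {c N H : ℕ} {w : ℕ → Fin (N + 1) → Fin (c + 1)}

theorem concat_add (hN : 0 < N) (hw : ∀ j, w j ∈ loops c N H) (j : ℕ) (i : Fin (N + 1)) :
    concat w (j * N + i) = w j i := by
  unfold concat
  have hlt := i.2
  rcases (by omega : (i : ℕ) < N ∨ (i : ℕ) = N) with hi | hi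
  · rw [mul_comm, Nat.mul_add_div hN, Nat.mul_add_mod, Nat.div_eq_of_lt hi, Nat.mod_eq_of_lt hi,
      add_zero]
    congr 1
    exact Fin.ext (Nat.mod_eq_of_lt hlt)
  · have h1 := hw j
    have h2 := hw (j + 1)
    simp only [loops, words, Finset.mem_filter, Finset.mem_singleton] at h1 h2
    obtain rfl : i = Fin.last N := Fin.ext hi
    rw [hi, ← Nat.succ_mul, Nat.mul_div_cancel _ hN, Nat.mul_mod_left, h1.1.2.2.2]
    exact h2.1.2.1

theorem concat_zero (hw : ∀ j, w j ∈ loops c N H) : concat w 0 = 0 := by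
  have h1 := hw 0
  simp only [loops, words, Finset.mem_filter] at h1
  simpa [concat] using h1.1.2.1

theorem transition_concat (hN : 0 < N) (hw : ∀ j, w j ∈ loops c N H) (n : ℕ) :
    transition c (concat w n) (concat w (n + 1)) = 1 := by
  have hlt := Nat.mod_lt n hN
  let i : Fin N := ⟨n % N, hlt⟩
  have hn : n = n / N * N + i.castSucc := (Nat.div_add_mod' n N).symm
  have hn' : n + 1 = n / N * N + i.succ := by
    rw [Fin.val_succ]; have := Nat.div_add_mod' n N; change _ = _ + (n % N + 1); omega
  have h1 := hw (n / N)
  simp only [loops, words, Finset.mem_filter] at h1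
  have h2 := h1.1.2.2.1 i
  rwa [← concat_add hN hw, ← concat_add hN hw, ← hn, ← hn'] at h2

theorem heights_concat_mul (hN : 0 < N) (hw : ∀ j, w j ∈ loops c N H) (j : ℕ) :
    heights (concat w) (j * N) = j * H := by
  induction j with
  | zero => simp [heights]
  | succ j ih =>
    have h1 := hw j
    simp only [loops, Finset.mem_filter] at h1
    unfold heights at ih ⊢
    rw [Nat.succ_mul, Finset.sum_range_add, ih, Nat.succ_mul, ← h1.2, wordHeight,
      Finset.sum_range]
    congr 1
    refine Finset.sum_congr rfl fun k _ => ?_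
    rw [← concat_add hN hw, ← concat_add hN hw, Fin.val_succ, Fin.val_castSucc, add_assoc]

theorem isHalfLift_concat (hN : 0 < N) (hw : ∀ j, w j ∈ loops c N H) :
    IsHalfLift c (heights (concat w)) :=
  isHalfLift_heights (concat_zero hw) (transition_concat hN hw)

/-- Both height functions equal `j * H` at `j * N`, and a multiple of `N` lies between `t` and `t +
N`. This is why the loops share a height. -/
theorem heights_concat_le {w' : ℕ → Fin (N + 1) → Fin (c + 1)} (hN : 0 < N)
    (hw : ∀ j, w j ∈ loops c N H) (hw' : ∀ j, w' j ∈ loops c N H) (t : ℕ) :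
    heights (concat w) t ≤ heights (concat w') (t + N) := by
  have h1 := Nat.div_add_mod' t N
  have h2 := Nat.mod_lt t hN
  calc heights (concat w) t ≤ heights (concat w) ((t / N + 1) * N) :=
        (isHalfLift_concat hN hw).monotone (by rw [Nat.succ_mul]; omega)
    _ = heights (concat w') ((t / N + 1) * N) := by
        rw [heights_concat_mul hN hw, heights_concat_mul hN hw']
    _ ≤ heights (concat w') (t + N) :=
        (isHalfLift_concat hN hw').monotone (by rw [Nat.succ_mul]; omega)

end Concat

/-! ### Lower bound -/

/-- The sequence of loops with prescribed loops in the positions `1, …, J`. -/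
def loopSeq {c N H J : ℕ} (d : loops c N H) (u : Fin J → loops c N H) (j : ℕ) :
    Fin (N + 1) → Fin (c + 1) :=
  -- Truncated subtraction gives position `0` a copy of loop `1` when `J > 0`. This is harmless:
  -- decoding starts at letter `N`.
  if h : j - 1 < J then u ⟨j - 1, h⟩ else d

theorem loopSeq_mem {c N H J : ℕ} (d : loops c N H) (u : Fin J → loops c N H) (j : ℕ) :
    loopSeq d u j ∈ loops c N H := by
  unfold loopSeq
  split_ifs
  · exact (u _).2
  · exact d.2

theorem loopSeq_succ {c N H J : ℕ} (d : loops c N H) (u : Fin J → loops c N H) (j : Fin J) :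
    loopSeq d u (j + 1) = u j := by
  simp [loopSeq]

theorem eq_of_concat_loopSeq_eq {c N H J : ℕ} (hN : 0 < N) (d : loops c N H)
    {u u' : Fin J → loops c N H}
    (h : ∀ s < J * N, concat (loopSeq d u) (s + N) = concat (loopSeq d u') (s + N)) : u = u' := by
  funext j
  apply Subtype.ext
  funext i
  have hlt := i.2
  rcases (by omega : (i : ℕ) < N ∨ (i : ℕ) = N) with hi | hi
  · have hs : (j : ℕ) * N + i < J * N := by
      have : ((j : ℕ) + 1) * N ≤ J * N := Nat.mul_le_mul_right N j.2
      rw [Nat.succ_mul] at this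
      omega
    have := h _ hs
    rw [show (j : ℕ) * N + i + N = (j + 1) * N + i by ring, concat_add hN (loopSeq_mem d u),
      concat_add hN (loopSeq_mem d u'), loopSeq_succ, loopSeq_succ] at this
    exact this
  · obtain rfl : i = Fin.last N := Fin.ext hi
    have h1 := (u j).2
    have h2 := (u' j).2
    simp only [loops, words, Finset.mem_filter, Finset.mem_singleton] at h1 h2
    rw [h1.1.2.2.2, h2.1.2.2.2]

/-- The configuration in which two sequences of loops run into each other. -/
def collision {c N H J : ℕ} (d : loops c N H) (p : (Fin J → loops c N H) × (Fin J → loops c N H)) :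
    ℤ → Fin (c + 1) :=
  ofHeight c (joinHeights (heights (concat (loopSeq d p.1))) (heights (concat (loopSeq d p.2))))

theorem collision_mem_Z {c N H J : ℕ} (hN : 0 < N) (d : loops c N H)
    (p : (Fin J → loops c N H) × (Fin J → loops c N H)) : collision d p ∈ Z c :=
  ofHeight_joinHeights_mem_Z (isHalfLift_concat hN (loopSeq_mem d p.1))
    (isHalfLift_concat hN (loopSeq_mem d p.2))

theorem T_iterate_collision {e r N H J : ℕ} (he : 1 ≤ e) (hr : 1 ≤ r) (hN : 0 < N)
    (d : loops (e + r) N H) (p : (Fin J → loops (e + r) N H) × (Fin J → loops (e + r) N H))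
    (t : ℕ) {s : ℕ} (hs : N ≤ s) :
    (T e r)^[t] (collision d p) s = concat (loopSeq d p.1) (t + s) ∧
      (T e r)^[t] (collision d p) (-s) = concat (loopSeq d p.2) (t + s) := by
  have m1 := loopSeq_mem d p.1
  have m2 := loopSeq_mem d p.2
  have h1 := isHalfLift_concat hN m1
  have h2 := isHalfLift_concat hN m2
  unfold collision
  rw [T_iterate_ofHeight he hr (h1.isLift_joinHeights h2)]
  unfold ofHeight
  rw [maxStep_joinHeights_right h1 h2 (heights_concat_le hN m2 m1) t hs,
    maxStep_joinHeights_left h1 h2 (heights_concat_le hN m1 m2) t hs]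
  exact ⟨ofNat_heights (concat_zero m1) (transition_concat hN m1) _,
    ofNat_heights (concat_zero m2) (transition_concat hN m2) _⟩

theorem eq_of_iterate_collision_eq {e r N H a l : ℕ} (he : 1 ≤ e) (hr : 1 ≤ r) (hN : 0 < N)
    (d : loops (e + r) N H)
    {p p' : (Fin (a * l) → loops (e + r) N H) × (Fin (a * l) → loops (e + r) N H)}
    (h : ∀ k < N * l, ∀ j : ℤ, |j| ≤ (N + a : ℕ) →
      ((T e r)^[a])^[k] (collision d p) j = ((T e r)^[a])^[k] (collision d p') j) : p = p' := by
  -- At time `a * k` the cells `N, …, N + a` show the letters from `a * k + N` to `a * k + N + a`,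
  -- so successive observations leave no gap.
  have key : ∀ s < a * l * N, ∃ k < N * l, ∃ i ≤ a, a * k + (N + i) = s + N := by
    intro s hs
    have ha : 0 < a := by
      rcases Nat.eq_zero_or_pos a with rfl | ha
      · simp at hs
      · exact ha
    refine ⟨s / a, ?_, s % a, (Nat.mod_lt s ha).le, ?_⟩
    · rw [Nat.div_lt_iff_lt_mul ha]
      calc s < a * l * N := hs
        _ = N * l * a := by ring
    · have := Nat.div_add_mod s a
      omega
  refine Prod.ext (eq_of_concat_loopSeq_eq hN d fun s hs => ?_)
    (eq_of_concat_loopSeq_eq hN d fun s hs => ?_)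
  · obtain ⟨k, hk, i, hi, hki⟩ := key s hs
    have h1 := h k hk ((N + i : ℕ) : ℤ) (by rw [Nat.abs_cast]; exact_mod_cast (by omega))
    rw [← Function.iterate_mul, (T_iterate_collision he hr hN d p _ (by omega)).1,
      (T_iterate_collision he hr hN d p' _ (by omega)).1, hki] at h1
    exact h1
  · obtain ⟨k, hk, i, hi, hki⟩ := key s hs
    have h1 := h k hk (-((N + i : ℕ) : ℤ)) (by
      rw [abs_neg, Nat.abs_cast]; exact_mod_cast (by omega))
    rw [← Function.iterate_mul, (T_iterate_collision he hr hN d p _ (by omega)).2,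
      (T_iterate_collision he hr hN d p' _ (by omega)).2, hki] at h1
    exact h1

/-- In `N * l` steps of `T^a` each side reveals `a * l` loops, so `card ^ (2 * a * l)` collisions
are distinguished. -/
theorem log_card_loops_le_topEntropy {e r N H : ℕ} (he : 1 ≤ e) (hr : 1 ≤ r) (hN : 0 < N)
    (hne : (loops (e + r) N H).Nonempty) (a : ℕ) :
    ((2 * a * (Real.log (loops (e + r) N H).card / N) : ℝ) : EReal) ≤
      topEntropy ((T e r)^[a]) (Z (e + r)) := by
  classical
  obtain ⟨d, hd⟩ := hne
  let d : loops (e + r) N H := ⟨d, hd⟩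
  have htend : Tendsto (fun l : ℕ => N * l) atTop atTop := tendsto_id.const_mul_atTop' hN
  refine le_topEntropy (N + a) (htend.frequently (Eventually.frequently
    (Eventually.of_forall fun l => ?_)))
  have hinj : Function.Injective (collision (J := a * l) d) := fun p p' hpp' =>
    eq_of_iterate_collision_eq he hr hN d fun k _ j _ => by rw [hpp']
  refine ⟨Finset.univ.image (collision (J := a * l) d), ?_, ?_, ?_⟩
  · rw [Finset.card_image_of_injective _ hinj]
    have hpos : (0 : ℝ) < (loops (e + r) N H).card := by
      exact_mod_cast Finset.card_pos.2 ⟨d.1, d.2⟩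
    have hN' : (N : ℝ) ≠ 0 := by exact_mod_cast hN.ne'
    rw [show 2 * a * (Real.log (loops (e + r) N H).card / N) * ((N * l : ℕ) : ℝ) =
      ((2 * (a * l) : ℕ) : ℝ) * Real.log (loops (e + r) N H).card by
        push_cast; field_simp, Real.exp_nat_mul, Real.exp_log hpos]
    simp only [Finset.card_univ, Fintype.card_prod, Fintype.card_fun, Fintype.card_fin,
      Fintype.card_coe]
    push_cast
    apply le_of_eq; ring
  · intro x hx
    obtain ⟨p, -, rfl⟩ := Finset.mem_image.1 hx
    exact collision_mem_Z hN d p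
  · intro x hx y hy hxy
    obtain ⟨p, -, rfl⟩ := Finset.mem_image.1 hx
    obtain ⟨p', -, rfl⟩ := Finset.mem_image.1 hy
    rw [eq_of_iterate_collision_eq he hr hN d hxy]

/-- Pigeonhole over the possible heights `0, …, N`. -/
theorem exists_card_words_le_mul_card_loops (c N : ℕ) :
    ∃ H, (words c {0} N 0).card ≤ (N + 1) * (loops c N H).card := by
  have hle : ∀ w : Fin (N + 1) → Fin (c + 1), wordHeight w ≤ N := fun w => by
    refine (Finset.sum_le_card_nsmul _ _ 1 fun k _ => ?_).trans (by simp)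
    unfold rise; split_ifs <;> omega
  by_contra! h
  have h1 := Finset.card_eq_sum_card_fiberwise (s := words c {0} N 0) (f := wordHeight)
    (t := Finset.range (N + 1)) fun w _ => by simpa using Nat.lt_succ_of_le (hle w)
  have h2 : ∑ H ∈ Finset.range (N + 1), (N + 1) * (loops c N H).card <
      ∑ H ∈ Finset.range (N + 1), (words c {0} N 0).card :=
    Finset.sum_lt_sum_of_nonempty (by simp) fun H _ => h H
  rw [← Finset.mul_sum, Finset.sum_const, Finset.card_range, smul_eq_mul] at h2
  exact absurd h1 (Nat.ne_of_gt (Nat.lt_of_mul_lt_mul_left h2))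

theorem le_topEntropy_Z {e r : ℕ} (he : 1 ≤ e) (hr : 1 ≤ r) (a : ℕ) :
    ((2 * Real.log (rho (e + r) ^ a) : ℝ) : EReal) ≤ topEntropy ((T e r)^[a]) (Z (e + r)) := by
  have hc : 1 ≤ e + r := by omega
  set lam := Real.log (rho (e + r)) with hlam
  have hbound : ∀ᶠ N : ℕ in atTop,
      -- The losses are the `c` transitions spent on returning to `0` and the pigeonhole factor `N +
      -- 1 ≤ 2 * N`; both vanish after division by `N`.
      ((2 * a * (lam - ((e + r : ℕ) * lam + Real.log 2) / N - Real.log N / N) : ℝ) : EReal) ≤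
        topEntropy ((T e r)^[a]) (Z (e + r)) := by
    filter_upwards [eventually_ge_atTop (e + r)] with N hN
    obtain ⟨H, hH⟩ := exists_card_words_le_mul_card_loops (e + r) N
    have hw := le_card_words_zero hc (N - (e + r)) 0
    rw [Nat.add_sub_cancel' hN, weight, if_pos rfl, one_mul] at hw
    have hρ := pow_pos (rho_pos (e + r)) (N - (e + r))
    have hN0 : (1 : ℝ) ≤ N := by exact_mod_cast hc.trans hN
    have h1 : rho (e + r) ^ (N - (e + r)) ≤ 2 * N * (loops (e + r) N H).card := by
      refine hw.trans ((Nat.cast_le.2 hH).trans ?_)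
      push_cast
      gcongr
      linarith
    have hpos : (0 : ℝ) < (loops (e + r) N H).card := by
      by_contra! h
      nlinarith [mul_nonneg (by positivity : (0 : ℝ) ≤ 2 * N) (sub_nonneg.2 h)]
    refine le_trans ?_ (log_card_loops_le_topEntropy he hr (hc.trans hN)
      (Finset.card_pos.1 (by exact_mod_cast hpos)) a)
    have h2 := Real.log_le_log hρ h1
    rw [Real.log_pow, Real.log_mul (by positivity) hpos.ne', Real.log_mul two_ne_zero (by positivity),
      Nat.cast_sub hN, ← hlam] at h2
    rw [EReal.coe_le_coe_iff]
    gcongr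
    have : lam - ((e + r : ℕ) * lam + Real.log 2) / N - Real.log N / N =
        ((N - (e + r : ℕ)) * lam - Real.log 2 - Real.log N) / N := by
      field_simp; ring
    rw [this]
    gcongr
    linarith
  refine le_of_tendsto ?_ hbound
  refine (continuous_coe_real_ereal.tendsto _).comp ?_
  have h1 : Tendsto (fun N : ℕ => ((e + r : ℕ) * lam + Real.log 2) / N) atTop (nhds 0) :=
    tendsto_const_div_atTop_nhds_zero_nat _
  have h2 : Tendsto (fun N : ℕ => Real.log N / N) atTop (nhds 0) :=
    Real.isLittleO_log_id_atTop.tendsto_div_nhds_zero.comp tendsto_natCast_atTop_atTop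
  have h3 := ((h1.const_sub lam).sub h2).const_mul (2 * a : ℝ)
  rw [Real.log_pow]
  convert h3 using 2
  rw [sub_zero, sub_zero]; ring

theorem topEntropy_Z {e r : ℕ} (he : 1 ≤ e) (hr : 1 ≤ r) (a : ℕ) :
    topEntropy ((T e r)^[a]) (Z (e + r)) = ((2 * Real.log (rho (e + r) ^ a) : ℝ) : EReal) :=
  le_antisymm (topEntropy_Z_le (by omega) a) (le_topEntropy_Z he hr a)

theorem toReal_topEntropy_Z_isEquivalent (α : ℕ → ℕ) :
    IsEquivalent sumToInfinity
      (fun p : ℕ × ℕ =>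
        (topEntropy ((T p.1 p.2)^[α (p.1 + p.2)]) (Z (p.1 + p.2))).toReal)
      (fun p : ℕ × ℕ => 2 * (α (p.1 + p.2) : ℝ) *
        (Real.log ((p.1 + p.2 : ℕ) : ℝ) / ((p.1 + p.2 : ℕ) : ℝ))) := by
  have ht : Tendsto (fun p : ℕ × ℕ => p.1 + p.2) sumToInfinity atTop :=
    tendsto_comap.mono_left inf_le_left
  refine ((two_mul_log_rho_pow_isEquivalent α).comp_tendsto ht).congr_left ?_
  filter_upwards [mem_inf_of_right (mem_principal_self {p : ℕ × ℕ | 1 ≤ p.1 ∧ 1 ≤ p.2})] with p hp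
  rw [topEntropy_Z hp.1 hp.2, EReal.toReal_coe]
  rfl

end GreenbergHastings


theorem mainTheorem7 (α : ℕ → ℕ) :
    (∀ c : ℕ, 1 ≤ c → IsGreatest (positiveRoots c) (rho c)) ∧
    (∀ e r : ℕ, 1 ≤ e → 1 ≤ r →
      topEntropy ((T e r)^[α (e + r)]) (Z (e + r)) =
        ((2 * Real.log (rho (e + r) ^ α (e + r)) : ℝ) : EReal)) ∧
    IsEquivalent atTop (fun c : ℕ => 2 * Real.log (rho c ^ α c))
      (fun c : ℕ => 2 * (α c : ℝ) * (Real.log (c : ℝ) / (c : ℝ))) ∧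
    IsEquivalent sumToInfinity
      (fun p : ℕ × ℕ =>
        (topEntropy ((T p.1 p.2)^[α (p.1 + p.2)]) (Z (p.1 + p.2))).toReal)
      (fun p : ℕ × ℕ => 2 * (α (p.1 + p.2) : ℝ) *
        (Real.log ((p.1 + p.2 : ℕ) : ℝ) / ((p.1 + p.2 : ℕ) : ℝ))) ∧
    (∀ c : ℕ, 1 ≤ c →
      topEntropy (leftShift : (ℤ → Fin c) → (ℤ → Fin c)) Set.univ =
        ((Real.log (c : ℝ) : ℝ) : EReal)) ∧
    IsEquivalent sumToInfinity
      (fun p : ℕ × ℕ => (topEntropy ((T p.1 p.2)^[p.1 + p.2]) (Z (p.1 + p.2))).toReal)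
      (fun p : ℕ × ℕ => 2 *
        (topEntropy (leftShift : (ℤ → Fin (p.1 + p.2)) → (ℤ → Fin (p.1 + p.2)))
          Set.univ).toReal) := by
  refine ⟨fun c _ => isGreatest_rho c, fun e r he hr => topEntropy_Z he hr _,
    two_mul_log_rho_pow_isEquivalent α, toReal_topEntropy_Z_isEquivalent α, topEntropy_fullShift, ?_⟩
  refine (toReal_topEntropy_Z_isEquivalent fun c => c).congr_right ?_
  filter_upwards [mem_inf_of_right (mem_principal_self {p : ℕ × ℕ | 1 ≤ p.1 ∧ 1 ≤ p.2})] with p hp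
  have hpos : 1 ≤ p.1 + p.2 := le_add_right hp.1
  have hne : ((p.1 + p.2 : ℕ) : ℝ) ≠ 0 := by exact_mod_cast (Nat.pos_iff_ne_zero.1 hpos)
  rw [topEntropy_fullShift _ hpos, EReal.toReal_coe, mul_assoc, mul_div_cancel₀ _ hne]
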